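/- A numeration system is an increasing sequence of integers $U=(U_n)_{n\ge 0}$ with $U_0=1$ and $C_U:=\sup_{n\ge 0}\lceil U_{n+1}/U_n\rceil<\infty$; put $A_U=\{0,\dots,C_U-1\}$. For $n\ge 1$ the greedy representation $\mathrm{rep}_U(n)=w_{\ell-1}\cdots w_0$ is the unique word over $A_U$ with $w_{\ell-1}\ne 0$, $\sum_{i<\ell}w_iU_i=n$ and $\sum_{i<j}w_iU_i<U_j$ for $1\le j\le \ell$; $\mathrm{rep}_U(0)$ is the empty word. For a real number $\beta>1$, let $d_\beta(1)$ be the lexicographically greatest sequence $(x_i)_{i\ge 1}$ of natural numbers with $1=\sum_{i\ge 1}x_i\beta^{-i}$. If $d_\beta(1)=t_1\cdots t_m0^\omega$ with $t_m\neq 0$, put $d_\beta^*(1)=(t_1\cdots t_{m-1}(t_m-1))^\omega$; otherwise put $d_\beta^*(1)=d_\beta(1)$. The number $\beta$ is a Parry number if $d_\beta^*(1)$ is ultimately periodic. A Parry numeration system is a numeration system $U$ for which there is a Parry number $\beta$ such that, with $d_\beta^*(1)=(t_i)_{i\ge 1}$, one has $U_n=t_1U_{n-1}+\cdots+t_nU_0+1$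 for all $n\ge 0$. An infinite word $\mathbf{x}=(x_n)_{n\ge 0}$ over a finite alphabet $B$ is Parry-automatic if there are a Parry numeration system $U$ and a complete deterministic finite automaton with output $(Q,q_0,A_U,\delta,\tau)$, where $\tau\colon Q\to B$, such that $\delta(q_0,0)=q_0$ and $x_n=\tau(\delta(q_0,\mathrm{rep}_U(n)))$ for all $n\ge 0$. Let $p_{\mathbf{x}}(n)$ be the number of distinct factors of length $n$ of $\mathbf{x}$. **Theorem.** Every Parry-automatic sequence $\mathbf{x}$ has sublinear factor complexity: the function $p_{\mathbf{x}}$ is in $\mathcal{O}(1)$ or in $\Theta(n)$. In particular, $p_{\mathbf{x}}(n)=\mathcal{O}(n)$. -/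

import Mathlib

open scoped Asymptotics

namespace ParryAutomatic

/-! ### Positional numeration systems -/

/-- A positional numeration system: an increasing sequence of integers with `U₀ = 1` and with
`sup ⌈U_{n+1} / U_n⌉ < ∞`. -/
structure NumerationSystem where
  seq : ℕ → ℕ
  strictMono : StrictMono seq
  seq_zero : seq 0 = 1
  bddAbove : BddAbove (Set.range fun n => ⌈(seq (n + 1) : ℝ) / (seq n : ℝ)⌉₊)

namespace NumerationSystem

/-- The number `C_U = sup ⌈U_{n+1} / U_n⌉`. -/
noncomputable def C (U : NumerationSystem) : ℕ :=
  ⨆ n, ⌈(U.seq (n + 1) : ℝ) / (U.seq n : ℝ)⌉₊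

theorem seq_pos (U : NumerationSystem) (n : ℕ) : 0 < U.seq n := by
  have h := U.strictMono.monotone (Nat.zero_le n)
  rw [U.seq_zero] at h
  exact h

theorem seq_succ_le (U : NumerationSystem) (n : ℕ) : U.seq (n + 1) ≤ U.C * U.seq n := by
  have h1 : ⌈(U.seq (n + 1) : ℝ) / (U.seq n : ℝ)⌉₊ ≤ U.C := le_ciSup U.bddAbove n
  have h2 : (U.seq (n + 1) : ℝ) / (U.seq n : ℝ) ≤ (U.C : ℝ) :=
    (Nat.le_ceil _).trans (by exact_mod_cast h1)
  have h3 : (0 : ℝ) < U.seq n := by exact_mod_cast U.seq_pos n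
  rw [div_le_iff₀ h3] at h2
  exact_mod_cast h2

theorem two_le_C (U : NumerationSystem) : 2 ≤ U.C := by
  have h := U.seq_succ_le 0
  have h1 := U.strictMono (Nat.lt_succ_self 0)
  simp only [U.seq_zero, Nat.succ_eq_add_one, zero_add, mul_one] at h h1
  omega

instance (U : NumerationSystem) : NeZero U.C := ⟨by have := U.two_le_C; omega⟩

/-- The digit alphabet `A_U = {0, …, C_U - 1}`. -/
abbrev Digit (U : NumerationSystem) : Type := Fin U.C

/-- The numerical value `∑ w_i U_i` of a word `w_{ℓ-1} ⋯ w_0`, most significant digit first. -/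
def val (U : NumerationSystem) : List U.Digit → ℕ
  | [] => 0
  | d :: w => (d : ℕ) * U.seq w.length + U.val w

/-- `w = w_{ℓ-1} ⋯ w_0` is the greedy representation of `n`: its value is `n`, its leading letter
(if there is one) is nonzero, and `∑_{i < j} w_i U_i < U_j` for every `j ≤ ℓ`, that is, for every
suffix `w_{j-1} ⋯ w_0` of `w`. (For `j = 0` this reads `0 < 1`.) -/
def IsGreedyRep (U : NumerationSystem) (n : ℕ) (w : List U.Digit) : Prop :=
  U.val w = n ∧ (∀ d ∈ w.head?, d ≠ 0) ∧ ∀ s, s <:+ w → U.val s < U.seq s.length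

theorem existsUnique_isGreedyRep (U : NumerationSystem) (n : ℕ) :
    ∃! w, U.IsGreedyRep n w := by
  have hpad : ∀ l n, n < U.seq l → ∃ w : List U.Digit, w.length = l ∧ U.val w = n ∧
      ∀ s, s <:+ w → U.val s < U.seq s.length := by
    intro l
    induction l with
    | zero =>
      intro n hn
      rw [U.seq_zero] at hn
      refine ⟨[], rfl, ?_, ?_⟩
      · simp only [val]; omega
      · intro s hs
        rw [List.suffix_nil.mp hs]
        simp [val, U.seq_zero]
    | succ l ih =>
      intro n hn
      obtain ⟨w, hl, hv, hs⟩ := ih (n % U.seq l) (Nat.mod_lt _ (U.seq_pos l))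
      have hd : n / U.seq l < U.C :=
        Nat.div_lt_of_lt_mul (by rw [mul_comm]; exact hn.trans_le (U.seq_succ_le l))
      have hv' : U.val (⟨n / U.seq l, hd⟩ :: w) = n := by
        simp only [val, hl, hv]
        exact Nat.div_add_mod' _ _
      refine ⟨⟨n / U.seq l, hd⟩ :: w, by simp [hl], hv', ?_⟩
      intro s h
      rcases List.suffix_cons_iff.mp h with h | h
      · rw [h, hv']
        simpa [hl] using hn
      · exact hs s h
  have heq : ∀ v w : List U.Digit, v.length = w.length → U.val v = U.val w →
      (∀ s, s <:+ v → U.val s < U.seq s.length) →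
      (∀ s, s <:+ w → U.val s < U.seq s.length) → v = w := by
    intro v
    induction v with
    | nil =>
      intro w hl _ _ _
      exact (List.length_eq_zero_iff.mp hl.symm).symm
    | cons d v ih =>
      intro w hl hv h1 h2
      cases w with
      | nil => simp at hl
      | cons e w =>
        simp only [List.length_cons, Nat.add_right_cancel_iff] at hl
        have a1 := h1 v (List.suffix_cons d v)
        have a2 := h2 w (List.suffix_cons e w)
        simp only [val, hl] at hv
        rw [hl] at a1
        have hm : U.val v = U.val w := by
          have := congrArg (· % U.seq w.length) hv
          simpa [Nat.add_mod, Nat.mod_eq_of_lt a1,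
            Nat.mod_eq_of_lt a2] using this
        have hde : (d : ℕ) = e :=
          Nat.eq_of_mul_eq_mul_right (U.seq_pos w.length) (by omega)
        rw [Fin.ext hde, ih w hl hm (fun s h => h1 s (h.trans (List.suffix_cons d v)))
          (fun s h => h2 s (h.trans (List.suffix_cons e w)))]
  have hlow : ∀ v : List U.Digit, (∀ d ∈ v.head?, d ≠ 0) → v ≠ [] →
      U.seq (v.length - 1) ≤ U.val v := by
    intro v h hne
    cases v with
    | nil => exact absurd rfl hne
    | cons d v =>
      have hd : d ≠ 0 := h d (by simp)
      have hd' : 1 ≤ (d : ℕ) :=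
        Nat.one_le_iff_ne_zero.mpr (fun h0 => hd (Fin.ext (by simpa using h0)))
      simp only [val, List.length_cons, Nat.add_sub_cancel]
      nlinarith [U.seq_pos v.length]
  have hlen : ∀ v w : List U.Digit, U.IsGreedyRep n v → U.IsGreedyRep n w →
      v.length ≤ w.length := by
    rintro v w ⟨v1, v2, v3⟩ ⟨w1, w2, w3⟩
    by_contra! hlt
    have hne : v ≠ [] := by rintro rfl; simp at hlt
    have h1 := hlow v v2 hne
    have h2 := w3 w List.suffix_rfl
    have h3 := U.strictMono.monotone (show w.length ≤ v.length - 1 by omega)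
    omega
  have hex : ∃ l, n < U.seq l := ⟨n + 1, U.strictMono.le_apply.trans_lt' (Nat.lt_succ_self n)⟩
  classical
  obtain ⟨w, wl, wv, ws⟩ := hpad (Nat.find hex) n (Nat.find_spec hex)
  have hw : U.IsGreedyRep n w := by
    refine ⟨wv, ?_, ws⟩
    intro d hd h0
    cases w with
    | nil => simp at hd
    | cons e v =>
      simp only [List.head?_cons, Option.mem_def, Option.some.injEq] at hd
      subst hd
      subst h0
      have h1 := ws v (List.suffix_cons _ v)
      have h2 : n < U.seq v.length := by
        simp only [val, Fin.val_zero, zero_mul, zero_add] at wv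
        omega
      have := Nat.find_min' hex h2
      simp only [List.length_cons] at wl
      omega
  refine ⟨w, hw, fun v hv => ?_⟩
  exact heq v w (le_antisymm (hlen v w hv hw) (hlen w v hw hv)) (hv.1.trans hw.1.symm)
    hv.2.2 hw.2.2

/-- The greedy representation `rep_U(n)` of `n`. -/
noncomputable def rep (U : NumerationSystem) (n : ℕ) : List U.Digit :=
  (U.existsUnique_isGreedyRep n).choose

theorem isGreedyRep_rep (U : NumerationSystem) (n : ℕ) : U.IsGreedyRep n (U.rep n) :=
  (U.existsUnique_isGreedyRep n).choose_spec.1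

end NumerationSystem

/-! ### Expansions in a real base and Parry numeration systems

Sequences of digits `(x_i)_{i ≥ 1}` are indexed from `0`, so that `x i` stands for `x_{i+1}`. -/

/-- The remainders of the greedy algorithm: `r₀ = x` and `r_{i+1}` is the fractional part
of `β r_i`. -/
noncomputable def betaRemainder (β x : ℝ) : ℕ → ℝ
  | 0 => x
  | i + 1 => Int.fract (β * betaRemainder β x i)

/-- The `β`-expansion `d_β(x)` of `x ∈ [0, 1]`, by the greedy algorithm. It is the
lexicographically greatest `β`-representation of `x`: see `isGreatest_betaExpansion`. -/
noncomputable def betaExpansion (β x : ℝ) (i : ℕ) : ℕ :=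
  ⌊β * betaRemainder β x i⌋₊

/-- The sequences `(x_i)_{i ≥ 1}` of natural numbers with `x = ∑ x_i β^{-i}`, as elements of the
set of all sequences with the lexicographic order. -/
def betaRepresentations (β x : ℝ) : Set (Lex (ℕ → ℕ)) :=
  {d | HasSum (fun i => (ofLex d i : ℝ) * (β ^ (i + 1))⁻¹) x}

theorem betaRemainder_mem (β : ℝ) {x : ℝ} (hx : x ∈ Set.Icc (0 : ℝ) 1) (i : ℕ) :
    betaRemainder β x i ∈ Set.Icc (0 : ℝ) 1 := by
  cases i with
  | zero => exact hx
  | succ i => exact ⟨Int.fract_nonneg _, (Int.fract_lt_one _).le⟩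

theorem betaExpansion_sum {β x : ℝ} (hβ : 1 < β) (hx : x ∈ Set.Icc (0 : ℝ) 1) (n : ℕ) :
    ∑ i ∈ Finset.range n, (betaExpansion β x i : ℝ) * (β ^ (i + 1))⁻¹ +
      betaRemainder β x n * (β ^ n)⁻¹ = x := by
  induction n with
  | zero => simp [betaRemainder]
  | succ n ih =>
    have hb : β ≠ 0 := by positivity
    have h0 : 0 ≤ β * betaRemainder β x n :=
      mul_nonneg (by linarith) (betaRemainder_mem β hx n).1
    have h1 : (betaExpansion β x n : ℝ) + betaRemainder β x (n + 1) =
        β * betaRemainder β x n := by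
      rw [betaExpansion, natCast_floor_eq_intCast_floor h0]
      exact Int.floor_add_fract _
    rw [Finset.sum_range_succ, add_assoc, ← add_mul, h1]
    conv_rhs => rw [← ih]
    congr 1
    rw [pow_succ]
    field_simp

theorem isGreatest_betaExpansion {β x : ℝ} (hβ : 1 < β) (hx : x ∈ Set.Icc (0 : ℝ) 1) :
    IsGreatest (betaRepresentations β x) (toLex (betaExpansion β x)) := by
  have hb : 0 < β := by linarith
  constructor
  · have hnn : ∀ i, 0 ≤ (betaExpansion β x i : ℝ) * (β ^ (i + 1))⁻¹ := fun i => by positivity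
    show HasSum (fun i => (betaExpansion β x i : ℝ) * (β ^ (i + 1))⁻¹) x
    rw [hasSum_iff_tendsto_nat_of_nonneg hnn]
    have hpow : Filter.Tendsto (fun n : ℕ => (β ^ n)⁻¹) Filter.atTop (nhds 0) :=
      (tendsto_pow_atTop_atTop_of_one_lt hβ).inv_tendsto_atTop
    have h0 : Filter.Tendsto (fun n : ℕ => betaRemainder β x n * (β ^ n)⁻¹) Filter.atTop
        (nhds 0) := by
      refine squeeze_zero (fun n => ?_) (fun n => ?_) hpow
      · exact mul_nonneg (betaRemainder_mem β hx n).1 (by positivity)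
      · exact mul_le_of_le_one_left (by positivity) (betaRemainder_mem β hx n).2
    have h1 := (tendsto_const_nhds (x := x)).sub h0
    rw [sub_zero] at h1
    refine h1.congr fun n => ?_
    have := betaExpansion_sum hβ hx n
    linarith
  · intro e he
    by_contra hlt
    rw [not_le] at hlt
    obtain ⟨k, hk, hk'⟩ := hlt
    change ∀ j, j < k → betaExpansion β x j = ofLex e j at hk
    change betaExpansion β x k < ofLex e k at hk'
    have he' : HasSum (fun i => (ofLex e i : ℝ) * (β ^ (i + 1))⁻¹) x := he
    have h1 := sum_le_hasSum (Finset.range (k + 1)) (fun i _ => by positivity) he'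
    have h2 := betaExpansion_sum hβ hx k
    have h3 : ∑ i ∈ Finset.range k, (ofLex e i : ℝ) * (β ^ (i + 1))⁻¹ =
        ∑ i ∈ Finset.range k, (betaExpansion β x i : ℝ) * (β ^ (i + 1))⁻¹ :=
      Finset.sum_congr rfl fun i hi => by rw [hk i (Finset.mem_range.mp hi)]
    rw [Finset.sum_range_succ, h3] at h1
    have h4 : β * betaRemainder β x k < (ofLex e k : ℝ) := by
      have := Nat.lt_floor_add_one (β * betaRemainder β x k)
      have h5 : ((betaExpansion β x k : ℕ) : ℝ) + 1 ≤ (ofLex e k : ℝ) := by exact_mod_cast hk'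
      exact this.trans_le h5
    have h6 : betaRemainder β x k * (β ^ k)⁻¹ =
        β * betaRemainder β x k * (β ^ (k + 1))⁻¹ := by
      rw [pow_succ]
      field_simp
    have h7 : β * betaRemainder β x k * (β ^ (k + 1))⁻¹ <
        (ofLex e k : ℝ) * (β ^ (k + 1))⁻¹ :=
      mul_lt_mul_of_pos_right h4 (by positivity)
    linarith

/-- `d = t_1 ⋯ t_m 0^ω` with `m = k + 1` and `t_m ≠ 0`. -/
def EndsAt (d : ℕ → ℕ) (k : ℕ) : Prop :=
  d k ≠ 0 ∧ ∀ i, k < i → d i = 0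

open Classical in
/-- For `d = d_β(1)`, the sequence `d_β^*(1)`: if `d = t_1 ⋯ t_m 0^ω` with `t_m ≠ 0`, it is
`(t_1 ⋯ t_{m-1} (t_m - 1))^ω`, and otherwise it is `d` itself. -/
noncomputable def quasiGreedy (d : ℕ → ℕ) : ℕ → ℕ :=
  if h : ∃ k, EndsAt d k then
    fun i => if i % (h.choose + 1) = h.choose then d h.choose - 1 else d (i % (h.choose + 1))
  else d

/-- The sequence `d_β^*(1)`. -/
noncomputable def dStar (β : ℝ) : ℕ → ℕ :=
  quasiGreedy (betaExpansion β 1)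

/-- A real number `β > 1` is a Parry number if `d_β^*(1)` is ultimately periodic. -/
def IsParryNumber (β : ℝ) : Prop :=
  1 < β ∧ ∃ N p : ℕ, 0 < p ∧ ∀ i, N ≤ i → dStar β (i + p) = dStar β i

/-- The numeration system `U` is the system `U_β` canonically associated with `β`:
`U_n = t_1 U_{n-1} + ⋯ + t_n U_0 + 1` for all `n ≥ 0`, where `d_β^*(1) = (t_i)_{i ≥ 1}`. -/
def NumerationSystem.IsCanonical (U : NumerationSystem) (β : ℝ) : Prop :=
  ∀ n, U.seq n = ∑ i ∈ Finset.range n, dStar β i * U.seq (n - 1 - i) + 1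

/-- A Parry numeration system. -/
def NumerationSystem.IsParry (U : NumerationSystem) : Prop :=
  ∃ β : ℝ, IsParryNumber β ∧ U.IsCanonical β

/-! ### Automatic sequences and factor complexity -/

/-- A complete deterministic automaton with output, reading letters of `A`, with set of states `Q`
(required to be finite where it is used) and with outputs in `B`. -/
structure DFAO (A Q B : Type*) where
  step : Q → A → Q
  start : Q
  output : Q → B

/-- The output of the automaton after reading the word `w` from left to right. -/
def DFAO.eval {A Q B : Type*} (M : DFAO A Q B) (w : List A) : B :=
  M.output (w.foldl M.step M.start)

/-- `x` is `U`-automatic. -/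
def IsAutomatic {B : Type*} (U : NumerationSystem) (x : ℕ → B) : Prop :=
  ∃ (Q : Type) (_ : Finite Q) (M : DFAO U.Digit Q B),
    M.step M.start 0 = M.start ∧ ∀ n, x n = M.eval (U.rep n)

/-- `x` is Parry-automatic. -/
def IsParryAutomatic {B : Type*} (x : ℕ → B) : Prop :=
  ∃ U : NumerationSystem, U.IsParry ∧ IsAutomatic U x

/-- The number of factors `x_i x_{i+1} ⋯ x_{i+n-1}` of length `n` of `x`. -/
noncomputable def factorComplexity {B : Type*} (x : ℕ → B) (n : ℕ) : ℕ :=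
  (Set.range fun (i : ℕ) (k : Fin n) => x (i + k)).ncard

/-- `p` is sublinear: it is in `O(1)` or in `Θ(n)`. In particular it is in `O(n)`. -/
def IsSublinear (p : ℕ → ℕ) : Prop :=
  (fun n => (p n : ℝ)) =O[Filter.atTop] (fun _ => (1 : ℝ)) ∨
    (fun n => (p n : ℝ)) =Θ[Filter.atTop] (fun n => (n : ℝ))

end ParryAutomatic

/-! By the Morse–Hedlund dichotomy (`factorComplexity_bounded_or_le`) only a linear upper bound is
needed. Write d_β^*(1) = t. Once the greedy digits have followed t up to index i, with k digits
still to be read, the admissible remainders are those below `tail t U i k`. So at every level k the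
word splits into blocks, each determined by an automaton state and an index i. Ultimate periodicity
leaves finitely many classes of i. The block lengths are comparable to U_k: `tail_le` bounds them by
U_k, and `exists_le_tail` bounds them below by U_{k-J} for a fixed J. Choosing k with U_k of order n
and all blocks of length at least n, each factor of length n lies in two consecutive blocks
(`exists_consecutive_blocks`). It is then given by boundedly many block types and an offset below
U_k, hence O(n) choices. -/

namespace ParryAutomatic

/-! ### Factor complexity: the Morse–Hedlund dichotomy -/

section FactorComplexity

variable {B : Type*}

/-- The factor of length `n` of `x` that starts at position `i`. -/
def factorAt (x : ℕ → B) (n i : ℕ) : Fin n → B := fun k => x (i + k)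

theorem factorComplexity_eq_ncard_range (x : ℕ → B) (n : ℕ) :
    factorComplexity x n = (Set.range (factorAt x n)).ncard := rfl

theorem factorAt_eq_iff {x : ℕ → B} {n i j : ℕ} :
    factorAt x n i = factorAt x n j ↔ ∀ k < n, x (i + k) = x (j + k) :=
  ⟨fun h k hk => congrFun h ⟨k, hk⟩, fun h => funext fun k => h k k.2⟩

theorem range_factorAt_eq_image (x : ℕ → B) (n : ℕ) :
    Set.range (factorAt x n) = (fun w k => w (Fin.castSucc k)) '' Set.range (factorAt x (n + 1)) := by
  rw [← Set.range_comp]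
  rfl

variable [Finite B]

theorem factorComplexity_le_succ (x : ℕ → B) (n : ℕ) :
    factorComplexity x n ≤ factorComplexity x (n + 1) := by
  rw [factorComplexity_eq_ncard_range, range_factorAt_eq_image]
  exact Set.ncard_image_le (Set.toFinite _)

/-- If there are as many factors of length `n + 1` as of length `n`, then every factor of length
`n` has a unique extension to the right. -/
theorem factorAt_succ_of_factorComplexity_eq {x : ℕ → B} {n : ℕ}
    (h : factorComplexity x (n + 1) = factorComplexity x n) {i j : ℕ}
    (hij : factorAt x n i = factorAt x n j) : factorAt x (n + 1) i = factorAt x (n + 1) j := by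
  rw [factorComplexity_eq_ncard_range x n, range_factorAt_eq_image,
    factorComplexity_eq_ncard_range] at h
  exact (Set.ncard_image_iff (Set.toFinite _)).mp h.symm ⟨i, rfl⟩ ⟨j, rfl⟩ hij

theorem forall_eq_of_factorComplexity_eq {x : ℕ → B} {n : ℕ}
    (h : factorComplexity x (n + 1) = factorComplexity x n) {i j : ℕ}
    (hij : factorAt x n i = factorAt x n j) (m : ℕ) : x (i + m) = x (j + m) := by
  have key : ∀ m, factorAt x n (i + m) = factorAt x n (j + m) := by
    intro m
    induction m with
    | zero => exact hij
    | succ m ih =>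
      have h1 := factorAt_eq_iff.mp (factorAt_succ_of_factorComplexity_eq h ih)
      rw [factorAt_eq_iff]
      intro k hk
      have := h1 (k + 1) (by omega)
      convert this using 2 <;> ring
  have := factorAt_eq_iff.mp (factorAt_succ_of_factorComplexity_eq h (key m)) 0 (by omega)
  simpa using this

/-- A factor of length n determines everything to its right, in particular the factor of length m at
the same position. -/
theorem factorComplexity_le_of_eq_succ {x : ℕ → B} {n : ℕ}
    (h : factorComplexity x (n + 1) = factorComplexity x n) (m : ℕ) :
    factorComplexity x m ≤ factorComplexity x n := by
  classical
  choose! g hg using fun (w : Fin n → B) (hw : w ∈ Set.range (factorAt x n)) => hw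
  have hsub : Set.range (factorAt x m) ⊆ (fun w => factorAt x m (g w)) '' Set.range (factorAt x n) := by
    rintro _ ⟨i, rfl⟩
    refine ⟨factorAt x n i, ⟨i, rfl⟩, ?_⟩
    rw [factorAt_eq_iff]
    intro k _
    exact forall_eq_of_factorComplexity_eq h (hg _ ⟨i, rfl⟩) k
  exact (Set.ncard_le_ncard hsub (Set.toFinite _)).trans (Set.ncard_image_le (Set.toFinite _))

/-- **Morse–Hedlund.** The factor complexity is bounded or at least `n` for every `n`. -/
theorem factorComplexity_bounded_or_le (x : ℕ → B) :
    (∃ K, ∀ m, factorComplexity x m ≤ K) ∨ ∀ n, n ≤ factorComplexity x n := by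
  by_cases h : ∃ n, factorComplexity x (n + 1) = factorComplexity x n
  · obtain ⟨n, hn⟩ := h
    exact Or.inl ⟨_, factorComplexity_le_of_eq_succ hn⟩
  · push Not at h
    exact Or.inr fun _ => (strictMono_nat_of_lt_succ fun n =>
      (factorComplexity_le_succ x n).lt_of_ne (h n).symm).le_apply

theorem isSublinear_of_le_mul {x : ℕ → B} {K : ℕ}
    (hK : ∀ n, 0 < n → factorComplexity x n ≤ K * n) : IsSublinear (factorComplexity x) := by
  rcases factorComplexity_bounded_or_le x with ⟨L, hL⟩ | h
  · refine Or.inl (Asymptotics.IsBigO.of_bound (L : ℝ) (Filter.Eventually.of_forall fun n => ?_))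
    simpa using hL n
  · refine Or.inr ⟨Asymptotics.IsBigO.of_bound (K : ℝ) ?_, Asymptotics.IsBigO.of_bound 1 ?_⟩
    · filter_upwards [Filter.eventually_gt_atTop 0] with n hn
      simpa using (by exact_mod_cast hK n hn : (factorComplexity x n : ℝ) ≤ K * n)
    · filter_upwards with n
      simpa using h n

end FactorComplexity

/-! ### The quasi-greedy expansion of one -/

section QuasiGreedy

/-- `q` is the sequence of remainders of an expansion of `1` in base `β` with digits `t`, where all
remainders lie in `(0, 1]`. -/
structure IsQuasiGreedyRemainder (β : ℝ) (t : ℕ → ℕ) (q : ℕ → ℝ) : Prop where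
  zero : q 0 = 1
  pos : ∀ i, 0 < q i
  le_one : ∀ i, q i ≤ 1
  succ : ∀ i, q (i + 1) = β * q i - t i

variable {β : ℝ}

theorem betaRemainder_one_mem (β : ℝ) (i : ℕ) : betaRemainder β 1 i ∈ Set.Icc (0 : ℝ) 1 :=
  betaRemainder_mem β (by simp) i

theorem betaRemainder_succ_eq (hβ : 1 < β) (i : ℕ) :
    betaRemainder β 1 (i + 1) = β * betaRemainder β 1 i - betaExpansion β 1 i := by
  have h0 : 0 ≤ β * betaRemainder β 1 i :=
    mul_nonneg (by linarith) (betaRemainder_one_mem β i).1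
  rw [betaExpansion, natCast_floor_eq_intCast_floor h0]
  rfl

theorem betaExpansion_eq_zero_of_betaRemainder {i : ℕ} (h : betaRemainder β 1 i = 0) :
    ∀ j, i ≤ j → betaExpansion β 1 j = 0 := by
  have key : ∀ j, i ≤ j → betaRemainder β 1 j = 0 := by
    intro j hj
    induction j, hj using Nat.le_induction with
    | base => exact h
    | succ j _ ih => simp [betaRemainder, ih]
  intro j hj
  simp [betaExpansion, key j hj]

/-- If all digits from `i` on vanish, the remainder is multiplied by `β` at each step. -/
theorem eq_pow_mul_of_digits_eq_zero {t : ℕ → ℕ} {q : ℕ → ℝ}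
    (hsucc : ∀ i, q (i + 1) = β * q i - t i) {i : ℕ} (h : ∀ j, i ≤ j → t j = 0) (n : ℕ) :
    q (i + n) = β ^ n * q i := by
  induction n with
  | zero => simp
  | succ n ih =>
    rw [← add_assoc, hsucc, ih, h (i + n) (by omega), pow_succ]
    push_cast
    ring

/-- A positive remainder would grow like a multiple of β^n and exceed 1. -/
theorem remainder_nonpos_of_digits_eq_zero (hβ : 1 < β) {t : ℕ → ℕ} {q : ℕ → ℝ}
    (hsucc : ∀ i, q (i + 1) = β * q i - t i) (hle : ∀ i, q i ≤ 1) {i : ℕ}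
    (h : ∀ j, i ≤ j → t j = 0) : q i ≤ 0 := by
  by_contra! hpos
  obtain ⟨n, hn⟩ := pow_unbounded_of_one_lt (q i)⁻¹ hβ
  have h1 := hle (i + n)
  rw [eq_pow_mul_of_digits_eq_zero hsucc h n] at h1
  have h2 := mul_lt_mul_of_pos_right hn hpos
  rw [inv_mul_cancel₀ hpos.ne'] at h2
  linarith

theorem betaRemainder_eq_zero_of_endsAt (hβ : 1 < β) {k : ℕ} (h : EndsAt (betaExpansion β 1) k) :
    betaRemainder β 1 (k + 1) = 0 :=
  le_antisymm (remainder_nonpos_of_digits_eq_zero hβ (betaRemainder_succ_eq hβ)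
    (fun i => (betaRemainder_one_mem β i).2) fun j hj => h.2 j hj) (betaRemainder_one_mem β _).1

theorem betaExpansion_zero_ne_zero (hβ : 1 < β) : betaExpansion β 1 0 ≠ 0 := by
  have : 0 < ⌊β⌋₊ := Nat.floor_pos.mpr hβ.le
  simpa [betaExpansion, betaRemainder] using this.ne'

theorem exists_endsAt_of_betaRemainder_eq_zero (hβ : 1 < β) {i : ℕ}
    (h : betaRemainder β 1 i = 0) : ∃ k, EndsAt (betaExpansion β 1) k := by
  classical
  have hz := betaExpansion_eq_zero_of_betaRemainder h
  refine ⟨Nat.findGreatest (fun j => betaExpansion β 1 j ≠ 0) i, ?_, fun j hj => ?_⟩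
  -- `Nat.findGreatest` defaults to 0 when no index qualifies; here index 0 itself does.
  · exact Nat.findGreatest_spec (P := fun j => betaExpansion β 1 j ≠ 0) (Nat.zero_le i)
      (betaExpansion_zero_ne_zero hβ)
  · by_cases hji : j ≤ i
    · exact not_not.mp (Nat.findGreatest_is_greatest hj hji)
    · exact hz j (by omega)

/-- If the greedy expansion ends at k, lowering its last digit by one turns the remainder 0 at k + 1
into 1, so the remainders restart with period k + 1 and never vanish. Otherwise the greedy
remainders are already positive. -/
theorem exists_isQuasiGreedyRemainder_dStar (hβ : 1 < β) :
    ∃ q, IsQuasiGreedyRemainder β (dStar β) q := by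
  have hmem := betaRemainder_one_mem β
  by_cases h : ∃ k, EndsAt (betaExpansion β 1) k
  · have hk := h.choose_spec
    have hd : ∀ i, dStar β i = if i % (h.choose + 1) = h.choose then
        betaExpansion β 1 h.choose - 1 else betaExpansion β 1 (i % (h.choose + 1)) := by
      intro i
      rw [dStar, quasiGreedy, dif_pos h]
    generalize h.choose = k at hk hd
    refine ⟨fun i => betaRemainder β 1 (i % (k + 1)), by simp [betaRemainder], fun i => ?_,
      fun i => (hmem _).2, fun i => ?_⟩
    · refine (hmem _).1.lt_of_ne' fun h0 => hk.1 ?_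
      exact betaExpansion_eq_zero_of_betaRemainder h0 k
        (Nat.lt_succ_iff.mp (Nat.mod_lt _ (Nat.succ_pos k)))
    · have hlt : i % (k + 1) < k + 1 := Nat.mod_lt i (Nat.succ_pos k)
      rw [hd i]
      by_cases hi : i % (k + 1) = k
      · have h1 : (i + 1) % (k + 1) = 0 := by
          rw [Nat.add_mod, hi]
          rcases k with _ | k
          · simp
          · rw [Nat.mod_eq_of_lt (show 1 < k + 1 + 1 by omega), Nat.mod_self]
        have h2 := betaRemainder_succ_eq hβ k
        rw [betaRemainder_eq_zero_of_endsAt hβ hk] at h2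
        have h3 : betaRemainder β 1 0 = 1 := rfl
        simp only [hi, h1, if_true, h3]
        rw [Nat.cast_sub (Nat.one_le_iff_ne_zero.mpr hk.1)]
        push_cast
        linarith
      · have h1 : (i + 1) % (k + 1) = i % (k + 1) + 1 := by
          have : 1 < k + 1 := by omega
          rw [Nat.add_mod, Nat.mod_eq_of_lt this, Nat.mod_eq_of_lt (by omega)]
        simp only [hi, h1, if_false]
        exact betaRemainder_succ_eq hβ _
  · have hd : dStar β = betaExpansion β 1 := by rw [dStar, quasiGreedy, dif_neg h]
    rw [hd]
    refine ⟨betaRemainder β 1, rfl, fun i => ?_, fun i => (hmem i).2, betaRemainder_succ_eq hβ⟩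
    exact (hmem i).1.lt_of_ne' fun h0 => h (exists_endsAt_of_betaRemainder_eq_zero hβ h0)

variable {t : ℕ → ℕ} {q : ℕ → ℝ}

/-- Remainders in (0, 1] force t_i < β q_i ≤ β q_j ≤ t_j + 1. -/
theorem IsQuasiGreedyRemainder.digit_mono (hq : IsQuasiGreedyRemainder β t q) (hβ : 1 < β)
    {i j : ℕ} (hij : q i ≤ q j) : t i ≤ t j := by
  have h1 := hq.pos (i + 1)
  have h2 := hq.le_one (j + 1)
  rw [hq.succ] at h1 h2
  have h3 : β * q i ≤ β * q j := mul_le_mul_of_nonneg_left hij (by linarith)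
  have : (t i : ℝ) < t j + 1 := by linarith
  exact Nat.lt_succ_iff.mp (by exact_mod_cast this)

theorem IsQuasiGreedyRemainder.digit_zero_pos (hq : IsQuasiGreedyRemainder β t q) (hβ : 1 < β) :
    0 < t 0 := by
  have h1 := hq.le_one 1
  rw [show 1 = 0 + 1 from rfl, hq.succ, hq.zero] at h1
  have : (0 : ℝ) < t 0 := by linarith
  exact_mod_cast this

theorem IsQuasiGreedyRemainder.exists_digit_ne_zero (hq : IsQuasiGreedyRemainder β t q)
    (hβ : 1 < β) (i : ℕ) : ∃ j, t (i + j) ≠ 0 := by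
  by_contra! h
  refine (hq.pos i).not_ge (remainder_nonpos_of_digits_eq_zero hβ hq.succ hq.le_one fun j hj => ?_)
  obtain ⟨m, rfl⟩ := Nat.exists_eq_add_of_le hj
  exact h m

end QuasiGreedy

/-! ### Tails of the recurrence of a canonical numeration system -/

section Tail

/-- The tail `t_{i+1} U_{k-1} + ⋯ + t_{i+k} U_0 + 1` of the recurrence that defines `U_{i+k}`. -/
def tail (t U : ℕ → ℕ) : ℕ → ℕ → ℕ
  | _, 0 => 1
  | i, k + 1 => t i * U k + tail t U (i + 1) k

variable {t U : ℕ → ℕ}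

theorem tail_eq_sum (i k : ℕ) :
    tail t U i k = ∑ j ∈ Finset.range k, t (i + j) * U (k - 1 - j) + 1 := by
  induction k generalizing i with
  | zero => rfl
  | succ k ih =>
    rw [tail, ih, Finset.sum_range_succ']
    have : ∀ j ∈ Finset.range k, t (i + 1 + j) * U (k - 1 - j) =
        t (i + (j + 1)) * U (k + 1 - 1 - (j + 1)) := by
      intro j _
      congr 2 <;> omega
    rw [Finset.sum_congr rfl this]
    simp
    ring

theorem tail_pos (i k : ℕ) : 0 < tail t U i k := by
  rw [tail_eq_sum]
  exact Nat.succ_pos _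

theorem tail_congr {i i' : ℕ} (h : ∀ j, t (i + j) = t (i' + j)) (k : ℕ) :
    tail t U i k = tail t U i' k := by
  simp [tail_eq_sum, h]

theorem mul_le_tail {i j k : ℕ} (h : j < k) : t (i + j) * U (k - 1 - j) ≤ tail t U i k := by
  rw [tail_eq_sum]
  exact (Finset.single_le_sum (f := fun j => t (i + j) * U (k - 1 - j))
    (fun _ _ => Nat.zero_le _) (Finset.mem_range.mpr h)).trans (Nat.le_succ _)

/-- If the leading digits agree, the order of the remainders passes to the next index. If they
differ, the extra U_k absorbs the rest of the smaller tail, which is at most U_k because q 0 = 1 is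
the largest remainder. -/
theorem tail_le_tail {β : ℝ} {q : ℕ → ℝ} (hβ : 1 < β) (hq : IsQuasiGreedyRemainder β t q)
    (hU : ∀ k, tail t U 0 k = U k) (k : ℕ) {i j : ℕ} (hij : q i ≤ q j) :
    tail t U i k ≤ tail t U j k := by
  induction k generalizing i j with
  | zero => exact le_rfl
  | succ k ih =>
    simp only [tail]
    rcases (hq.digit_mono hβ hij).eq_or_lt with h | h
    · rw [h]
      refine Nat.add_le_add_left (ih ?_) _
      rw [hq.succ, hq.succ, h]
      have := mul_le_mul_of_nonneg_left hij (by linarith : (0 : ℝ) ≤ β)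
      linarith
    · have h1 : tail t U (i + 1) k ≤ U k := by
        rw [← hU k]
        exact ih (by rw [hq.zero]; exact hq.le_one _)
      have h2 : (t i + 1) * U k ≤ t j * U k := Nat.mul_le_mul_right _ h
      rw [add_mul, one_mul] at h2
      omega

theorem tail_le {β : ℝ} {q : ℕ → ℝ} (hβ : 1 < β) (hq : IsQuasiGreedyRemainder β t q)
    (hU : ∀ k, tail t U 0 k = U k) (i k : ℕ) : tail t U i k ≤ U k := by
  rw [← hU k]
  exact tail_le_tail hβ hq hU k (by rw [hq.zero]; exact hq.le_one _)

/-- An index below `N + p` at which an ultimately periodic sequence has the same continuation. -/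
theorem exists_lt_forall_add_eq {N p : ℕ} (hp : 0 < p) (h : ∀ i, N ≤ i → t (i + p) = t i)
    (i : ℕ) : ∃ i' < N + p, ∀ j, t (i + j) = t (i' + j) := by
  induction i using Nat.strong_induction_on with
  | _ i ih =>
    by_cases hi : i < N + p
    · exact ⟨i, hi, fun _ => rfl⟩
    · obtain ⟨i', h1, h2⟩ := ih (i - p) (by omega)
      refine ⟨i', h1, fun j => ?_⟩
      rw [← h2 j, ← h (i - p + j) (by omega)]
      congr 1
      omega

/-- A single nonzero digit at a bounded distance suffices; the bound is uniform because only s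
starting indices matter. -/
theorem exists_le_tail (hU : Monotone U) (h0 : U 0 = 1) {s : ℕ}
    (hs : ∀ i, ∃ i' < s, ∀ j, t (i + j) = t (i' + j)) (hne : ∀ i, ∃ j, t (i + j) ≠ 0) :
    ∃ J, ∀ i k, U (k - J) ≤ tail t U i k := by
  choose g hg using hne
  refine ⟨(Finset.range s).sup g + 1, fun i k => ?_⟩
  obtain ⟨i', hi', h⟩ := hs i
  rw [tail_congr h]
  have hgs : g i' ≤ (Finset.range s).sup g := Finset.le_sup (Finset.mem_range.mpr hi')
  by_cases hk : g i' < k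
  · refine le_trans ?_ (mul_le_tail hk)
    refine le_trans (hU ?_) (Nat.le_mul_of_pos_left _ (Nat.pos_of_ne_zero (hg i')))
    omega
  -- The nonzero digit lies beyond the tail; the truncated index is 0, and the final 1 of the tail
  -- is enough.
  · rw [show k - ((Finset.range s).sup g + 1) = 0 by omega, h0]
    exact tail_pos _ _

end Tail

/-! ### Reading greedy representations arithmetically -/

namespace NumerationSystem

variable (U : NumerationSystem)

theorem IsCanonical.tail_eq {U : NumerationSystem} {β : ℝ} (h : U.IsCanonical β) (k : ℕ) :
    tail (dStar β) U.seq 0 k = U.seq k := by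
  rw [tail_eq_sum, h k]
  simp

theorem seq_le_pow_mul (k J : ℕ) : U.seq k ≤ U.C ^ J * U.seq (k - J) := by
  induction J with
  | zero => simp
  | succ J ih =>
    refine ih.trans ?_
    rw [pow_succ, mul_assoc]
    refine Nat.mul_le_mul_left _ ?_
    rcases Nat.eq_zero_or_pos (k - J) with h | h
    · rw [show k - (J + 1) = k - J by omega]
      exact Nat.le_mul_of_pos_left _ (by have := U.two_le_C; omega)
    · rw [show k - J = k - (J + 1) + 1 by omega]
      exact U.seq_succ_le _

variable {Q : Type*} (f : Q → U.Digit → Q)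

/-- The state reached from `q` by reading the `k` digits of `r < U_k` computed by the greedy
algorithm, padded with zeros on the left. -/
noncomputable def read : ℕ → Q → ℕ → Q
  | 0, q, _ => q
  | k + 1, q, r => read k (f q (Fin.ofNat U.C (r / U.seq k))) (r % U.seq k)

/-- No bound on d is needed: `Fin.ofNat` reduces it modulo `U.C` on both sides. -/
theorem read_succ {k r : ℕ} (hr : r < U.seq k) (q : Q) (d : ℕ) :
    U.read f (k + 1) q (d * U.seq k + r) = U.read f k (f q (Fin.ofNat U.C d)) r := by
  have hpos := U.seq_pos k
  rw [read, mul_comm d, Nat.mul_add_div hpos, Nat.div_eq_of_lt hr, add_zero, Nat.mul_add_mod,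
    Nat.mod_eq_of_lt hr]

theorem foldl_eq_read (w : List U.Digit) (hw : ∀ s, s <:+ w → U.val s < U.seq s.length) (q : Q) :
    w.foldl f q = U.read f w.length q (U.val w) := by
  induction w generalizing q with
  | nil => rfl
  | cons d w ih =>
    rw [List.foldl_cons, List.length_cons, val, read_succ U f (hw w (List.suffix_cons d w)),
      ih fun s hs => hw s (hs.trans (List.suffix_cons d w))]
    simp

theorem read_eq_of_le {q : Q} (hq : f q 0 = q) {k l n : ℕ} (hn : n < U.seq k) (hkl : k ≤ l) :
    U.read f l q n = U.read f k q n := by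
  induction l, hkl using Nat.le_induction with
  | base => rfl
  | succ l hl ih =>
    have := U.read_succ f (hn.trans_le (U.strictMono.monotone hl)) q 0
    rw [zero_mul, zero_add] at this
    rw [this, ← ih]
    simp [hq]

theorem foldl_rep_eq_read {q : Q} (hq : f q 0 = q) {n k : ℕ} (hn : n < U.seq k) :
    (U.rep n).foldl f q = U.read f k q n := by
  obtain ⟨h1, -, h3⟩ := U.isGreedyRep_rep n
  have h4 := h3 _ List.suffix_rfl
  rw [foldl_eq_read U f _ h3, h1]
  rw [h1] at h4
  rcases le_total k (U.rep n).length with h | h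
  · exact U.read_eq_of_le f hq hn h
  · exact (U.read_eq_of_le f hq h4 h).symm

end NumerationSystem

/-! ### Decomposition into blocks and the linear bound -/

section Blocks

variable {B Q : Type*} {U : NumerationSystem} (M : DFAO U.Digit Q B) (x : ℕ → B) (t : ℕ → ℕ)

/-- The word `x` carries, at position `a`, the block of level `k` of type `(q, i)`. -/
def IsBlock (k a : ℕ) (q : Q) (i : ℕ) : Prop :=
  ∀ r < tail t U.seq i k, x (a + r) = M.output (U.read M.step k q r)

variable {M x t}

/-- A digit below t_i lifts the constraint on later digits: every remainder below U_k occurs, so the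
index returns to 0. -/
theorem IsBlock.sub_of_lt {k a i d : ℕ} {q : Q} (h : IsBlock M x t (k + 1) a q i)
    (hU : ∀ k, tail t U.seq 0 k = U.seq k) (hd : d < t i) :
    IsBlock M x t k (a + d * U.seq k) (M.step q (Fin.ofNat U.C d)) 0 := by
  intro r hr
  rw [hU] at hr
  rw [add_assoc, h, U.read_succ _ hr]
  have : (d + 1) * U.seq k ≤ t i * U.seq k := Nat.mul_le_mul_right _ hd
  rw [add_mul, one_mul] at this
  rw [tail]
  omega

/-- A digit equal to t_i keeps following the expansion, so the index advances and the block may be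
shorter than U_k. -/
theorem IsBlock.sub_last {k a i : ℕ} {q : Q} (h : IsBlock M x t (k + 1) a q i)
    (hle : ∀ i k, tail t U.seq i k ≤ U.seq k) :
    IsBlock M x t k (a + t i * U.seq k) (M.step q (Fin.ofNat U.C (t i))) (i + 1) := by
  intro r hr
  rw [add_assoc, h, U.read_succ _ (hr.trans_le (hle _ _))]
  rw [tail]
  omega

theorem IsBlock.exists_sub {k a i d : ℕ} {q : Q} (h : IsBlock M x t (k + 1) a q i)
    (hU : ∀ k, tail t U.seq 0 k = U.seq k) (hle : ∀ i k, tail t U.seq i k ≤ U.seq k)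
    (hd : d ≤ t i) : ∃ q' i', IsBlock M x t k (a + d * U.seq k) q' i' := by
  rcases hd.eq_or_lt with rfl | hd
  · exact ⟨_, _, h.sub_last hle⟩
  · exact ⟨_, _, h.sub_of_lt hU hd⟩

theorem isBlock_prefix (h0 : M.step M.start 0 = M.start) (hx : ∀ n, x n = M.eval (U.rep n))
    (hU : ∀ k, tail t U.seq 0 k = U.seq k) (k : ℕ) : IsBlock M x t k 0 M.start 0 := by
  intro r hr
  rw [hU] at hr
  rw [zero_add, hx, DFAO.eval, U.foldl_rep_eq_read _ h0 hr]

/-- Every position lies in a block of level `k` which is followed by another block of level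
`k`. -/
theorem exists_consecutive_blocks (h0 : M.step M.start 0 = M.start)
    (hx : ∀ n, x n = M.eval (U.rep n)) (hU : ∀ k, tail t U.seq 0 k = U.seq k)
    (hle : ∀ i k, tail t U.seq i k ≤ U.seq k) (ht : 0 < t 0) (k n : ℕ) :
    ∃ a q i q' i', a ≤ n ∧ n < a + tail t U.seq i k ∧ IsBlock M x t k a q i ∧
      IsBlock M x t k (a + tail t U.seq i k) q' i' := by
  have hlarge : n < U.seq (k + (n + 1)) :=
    (by omega : n < k + (n + 1)).trans_le U.strictMono.le_apply
  -- The induction descends to level k from a level k + m so high that n lies in the prefix of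
  -- length U_{k+m}.
  generalize n + 1 = m at hlarge
  induction m generalizing k with
  | zero =>
    -- The prefix block of level k + 1 also has a sub-block for digit 1, as t 0 ≥ 1; it follows the
    -- prefix of length U_k.
    obtain ⟨q', i', h'⟩ := (isBlock_prefix h0 hx hU (k + 1)).exists_sub hU hle (d := 1) ht
    refine ⟨0, M.start, 0, q', i', Nat.zero_le _, ?_, isBlock_prefix h0 hx hU k, ?_⟩
    · simpa [hU] using hlarge
    · simpa [hU] using h'
  | succ m ih =>
    obtain ⟨a, q, i, q', i', han, hna, h, h'⟩ := ih (k + 1) (by convert hlarge using 2; ring)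
    obtain ⟨r, rfl⟩ := Nat.exists_eq_add_of_le han
    have hpos := U.seq_pos k
    have hdiv := Nat.div_add_mod' r (U.seq k)
    have hmod := Nat.mod_lt r hpos
    rw [Nat.add_lt_add_iff_left, tail] at hna
    have hd : r / U.seq k ≤ t i := by
      rw [← Nat.lt_succ_iff, Nat.div_lt_iff_lt_mul hpos, Nat.succ_mul]
      exact hna.trans_le (Nat.add_le_add_left (hle _ _) _)
    generalize r / U.seq k = d at hdiv hd
    -- The last sub-block is followed by the first sub-block of the parent's successor; any other
    -- one by its sibling with digit d + 1.
    rcases hd.eq_or_lt with rfl | hd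
    · obtain ⟨q'', i'', h''⟩ := h'.exists_sub hU hle (Nat.zero_le _)
      refine ⟨_, _, _, q'', i'', ?_, ?_, h.sub_last hle, ?_⟩
      · omega
      · omega
      · simpa [tail, add_assoc] using h''
    · obtain ⟨q'', i'', h''⟩ := h.exists_sub hU hle hd
      refine ⟨_, _, _, q'', i'', ?_, ?_, h.sub_of_lt hU hd, ?_⟩
      · omega
      · rw [hU]
        omega
      · rw [hU]
        rwa [add_assoc, ← Nat.succ_mul]

/-- The least level reaching the threshold overshoots by a factor of at most `U.C`. -/
theorem exists_level_and_seq_le (U : NumerationSystem) {n : ℕ} (hn : 0 < n) (J : ℕ) :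
    ∃ k, U.C ^ J * n ≤ U.seq k ∧ U.seq k ≤ U.C ^ (J + 1) * n := by
  classical
  have hex : ∃ k, U.C ^ J * n ≤ U.seq k := ⟨_, U.strictMono.le_apply⟩
  have hC := U.two_le_C
  refine ⟨Nat.find hex, Nat.find_spec hex, ?_⟩
  rcases hk : Nat.find hex with _ | k
  · rw [U.seq_zero]
    exact Nat.mul_pos (Nat.pow_pos (by omega)) hn
  · have := Nat.find_min hex (m := k) (by omega)
    rw [pow_succ, mul_comm (U.C ^ J), mul_assoc]
    exact (U.seq_succ_le k).trans (Nat.mul_le_mul_left _ (not_le.mp this).le)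

/-- The factor of length `n` at position `o` of the concatenation of two blocks of level `k`. -/
noncomputable def blockFactor (M : DFAO U.Digit Q B) (t : ℕ → ℕ) (s k n : ℕ)
    (c : (Q × Fin s) × Q × Fin (U.seq k)) : Fin n → B := fun m =>
  if (c.2.2 + m : ℕ) < tail t U.seq c.1.2 k then M.output (U.read M.step k c.1.1 (c.2.2 + m))
  else M.output (U.read M.step k c.2.1 (c.2.2 + m - tail t U.seq c.1.2 k))

/-- The index of the second block is not counted: it affects only the length of that block, and the
factor ends before the block does. -/
theorem factorComplexity_le_of_blocks [Finite Q] (h0 : M.step M.start 0 = M.start)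
    (hx : ∀ n, x n = M.eval (U.rep n)) (hU : ∀ k, tail t U.seq 0 k = U.seq k)
    (hle : ∀ i k, tail t U.seq i k ≤ U.seq k) (ht : 0 < t 0) {s : ℕ}
    (hs : ∀ i, ∃ i' < s, ∀ j, t (i + j) = t (i' + j)) {k n : ℕ}
    (hn : ∀ i, n ≤ tail t U.seq i k) :
    factorComplexity x n ≤ Nat.card Q ^ 2 * s * U.seq k := by
  have hsub : Set.range (factorAt x n) ⊆ Set.range (blockFactor M t s k n) := by
    rintro _ ⟨l, rfl⟩
    obtain ⟨a, q, i, q', i', hal, hla, h, h'⟩ :=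
      exists_consecutive_blocks h0 hx hU hle ht k l
    obtain ⟨o, rfl⟩ := Nat.exists_eq_add_of_le hal
    obtain ⟨u, hu, htu⟩ := hs i
    rw [Nat.add_lt_add_iff_left] at hla
    refine ⟨((q, ⟨u, hu⟩), q', ⟨o, hla.trans_le (hle i k)⟩), funext fun m => ?_⟩
    have hm := m.2
    simp only [blockFactor, factorAt, ← tail_congr (U := U.seq) htu]
    split_ifs with hom
    · rw [add_assoc, h _ hom]
    · have := hn i'
      rw [← h' _ (by omega)]
      congr 1
      omega
  refine (Set.ncard_le_ncard hsub (Set.finite_range _)).trans ?_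
  rw [← Set.image_univ]
  refine (Set.ncard_image_le Set.finite_univ).trans_eq ?_
  rw [Set.ncard_univ]
  simp only [Nat.card_prod, Nat.card_fin]
  ring

end Blocks

theorem exists_factorComplexity_le_mul {B : Type*} {x : ℕ → B} (hx : IsParryAutomatic x) :
    ∃ K, ∀ n, 0 < n → factorComplexity x n ≤ K * n := by
  obtain ⟨U, ⟨β, ⟨hβ, N, p, hp, hper⟩, hcan⟩, Q, _, M, h0, hM⟩ := hx
  obtain ⟨q, hq⟩ := exists_isQuasiGreedyRemainder_dStar hβ
  have hU := hcan.tail_eq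
  have hs := exists_lt_forall_add_eq hp hper
  obtain ⟨J, hJ⟩ := exists_le_tail U.strictMono.monotone U.seq_zero hs
    (hq.exists_digit_ne_zero hβ)
  refine ⟨Nat.card Q ^ 2 * (N + p) * U.C ^ (J + 1), fun n hn => ?_⟩
  obtain ⟨k, hk, hk'⟩ := exists_level_and_seq_le U hn J
  have hC : 0 < U.C ^ J := Nat.pow_pos (by have := U.two_le_C; omega)
  refine (factorComplexity_le_of_blocks (k := k) h0 hM hU (tail_le hβ hq hU)
    (hq.digit_zero_pos hβ) hs fun i => ?_).trans ?_
  -- Cancel C^J in C^J n ≤ U_k ≤ C^J U_{k-J} ≤ C^J `tail`.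
  · refine Nat.le_of_mul_le_mul_left (hk.trans ?_) hC
    exact (U.seq_le_pow_mul k J).trans (Nat.mul_le_mul_left _ (hJ i k))
  · rw [mul_assoc _ (U.C ^ (J + 1))]
    exact Nat.mul_le_mul_left _ hk'

end ParryAutomatic

theorem mainTheorem1 {B : Type*} [Finite B] (x : ℕ → B)
    (hx : ParryAutomatic.IsParryAutomatic x) :
    ParryAutomatic.IsSublinear (ParryAutomatic.factorComplexity x) := by
  obtain ⟨K, hK⟩ := ParryAutomatic.exists_factorComplexity_le_mul hx
  exact ParryAutomatic.isSublinear_of_le_mul hK
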